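/- Let $X$ be a non-reflexive (real or complex) Banach space. For $A \subset X^*$ let $\overline{A}^{\,*}$ denote the weak$^*$ closure of $A$, and let \[ A^{(1)} = \bigcup_{n=1}^\infty \overline{A \cap nB_{X^*}}^{\,*}, \] where $B_{X^*}$ is the closed unit ball of $X^*$, be its weak$^*$ derived set. Then there exists a convex subset $A \subset X^*$ such that $A^{(1)} \neq \overline{A}^{\,*}$. -/

import Mathlib

/-- A normed space `X` over `𝕜` is reflexive if the canonical embedding `X → X**` is onto. -/
def IsReflexiveSpace (𝕜 X : Type*) [RCLike 𝕜] [NormedAddCommGroup X] [NormedSpace 𝕜 X] : Prop :=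
  Function.Surjective (NormedSpace.inclusionInDoubleDual 𝕜 X)

/-- The weak* closure of a subset `A` of the dual space `X*`. -/
def weakStarClosure {𝕜 X : Type*} [RCLike 𝕜] [NormedAddCommGroup X] [NormedSpace 𝕜 X]
    (A : Set (StrongDual 𝕜 X)) : Set (StrongDual 𝕜 X) :=
  {f | StrongDual.toWeakDual f ∈ closure (StrongDual.toWeakDual '' A : Set (WeakDual 𝕜 X))}

/-- The weak* derived set `A⁽¹⁾` of a subset `A` of `X*`: the union over `n ≥ 1` of the weak*
closures of `A ∩ n B`, where `B` is the closed unit ball of `X*` in the dual norm. -/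
def weakStarDerivedSet {𝕜 X : Type*} [RCLike 𝕜] [NormedAddCommGroup X] [NormedSpace 𝕜 X]
    (A : Set (StrongDual 𝕜 X)) : Set (StrongDual 𝕜 X) :=
  ⋃ (n : ℕ) (_ : 1 ≤ n), weakStarClosure (A ∩ Metric.closedBall 0 (n : ℝ))

open Filter Topology

/-! Choose `F` in `X**` not coming from `X`, and `x ≠ 0`. Finitely many evaluations never control
`F`, so in the weak* topology the bound `re (F f) ≥ 1 / re (f x)` does not keep `f` away from `0`;
on norm-bounded sets `F` is bounded, so it does. -/

/-- A functional on `X*` outside the image of `X` takes every value on the annihilator of a finite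
subset of `X`. -/
theorem exists_forall_mem_eq_zero_and_apply_eq {𝕜 X : Type*} [RCLike 𝕜] [NormedAddCommGroup X]
    [NormedSpace 𝕜 X] {F : StrongDual 𝕜 (StrongDual 𝕜 X)}
    (hF : F ∉ Set.range (NormedSpace.inclusionInDoubleDual 𝕜 X)) (s : Finset X) (c : 𝕜) :
    ∃ v : StrongDual 𝕜 X, (∀ x ∈ s, v x = 0) ∧ F v = c := by
  by_cases h : ∃ v : StrongDual 𝕜 X, (∀ x ∈ s, v x = 0) ∧ F v ≠ 0
  · obtain ⟨v, hv, hv0⟩ := h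
    refine ⟨(c / F v) • v, fun x hx => by simp [hv x hx], ?_⟩
    rw [map_smul, smul_eq_mul, div_mul_cancel₀ _ hv0]
  · push Not at h
    -- Vanishing on a finite intersection of kernels makes `F` a combination of those evaluations.
    have hspan : (F : StrongDual 𝕜 X →ₗ[𝕜] 𝕜) ∈ Submodule.span 𝕜 (Set.range fun x : s =>
        (NormedSpace.inclusionInDoubleDual 𝕜 X x : StrongDual 𝕜 X →ₗ[𝕜] 𝕜)) := by
      refine mem_span_of_iInf_ker_le_ker fun v hv => h v fun x hx => ?_
      simpa using (Submodule.mem_iInf _).1 hv ⟨x, hx⟩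
    obtain ⟨c, hc⟩ := (Submodule.mem_span_range_iff_exists_fun 𝕜).1 hspan
    refine absurd ⟨∑ x : s, c x • (x : X), ?_⟩ hF
    ext v
    simpa using LinearMap.congr_fun hc v

/-- The functionals `f` with `0 < re (f x)` and `1 / re (f x) ≤ re (F f)`. -/
def reciprocalEpigraph {𝕜 X : Type*} [RCLike 𝕜] [NormedAddCommGroup X] [NormedSpace 𝕜 X]
    (F : StrongDual 𝕜 (StrongDual 𝕜 X)) (x : X) : Set (StrongDual 𝕜 X) :=
  {f | 0 < RCLike.re (f x) ∧ (RCLike.re (f x))⁻¹ ≤ RCLike.re (F f)}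

section

variable {𝕜 X : Type*} [RCLike 𝕜] [NormedAddCommGroup X] [NormedSpace 𝕜 X]
  {F : StrongDual 𝕜 (StrongDual 𝕜 X)} {x : X}

theorem convex_reciprocalEpigraph (F : StrongDual 𝕜 (StrongDual 𝕜 X)) (x : X) :
    Convex ℝ (reciprocalEpigraph F x) := by
  have hinv : ConvexOn ℝ (Set.Ioi (0 : ℝ)) fun t => t⁻¹ := by
    simpa using convexOn_zpow (𝕜 := ℝ) (-1)
  let L : StrongDual 𝕜 X →ₗ[ℝ] ℝ × ℝ :=
    { toFun := fun f => (RCLike.re (f x), RCLike.re (F f))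
      map_add' := fun f g => by simp
      map_smul' := fun r f => by
        simp [ContinuousLinearMap.map_smul_of_tower, RCLike.smul_re] }
  exact hinv.convex_epigraph.linear_preimage L

/-- With `h x = 1`, perturbing `t • h` by `v s`, which vanishes on `s` and at `x`, makes `F` equal
`1/t`. Let `s` grow, then `t → 0⁺`. -/
theorem zero_mem_weakStarClosure_reciprocalEpigraph
    (hF : F ∉ Set.range (NormedSpace.inclusionInDoubleDual 𝕜 X)) (hx : x ≠ 0) :
    0 ∈ weakStarClosure (reciprocalEpigraph F x) := by
  classical
  obtain ⟨h, hh⟩ := SeparatingDual.exists_eq_one (R := 𝕜) hx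
  have key : ∀ t : ℝ, 0 < t → StrongDual.toWeakDual ((t : 𝕜) • h) ∈
      closure (StrongDual.toWeakDual '' reciprocalEpigraph F x) := by
    intro t ht
    choose v hv hFv using fun s : Finset X =>
      exists_forall_mem_eq_zero_and_apply_eq hF (insert x s) (((t⁻¹ : ℝ) : 𝕜) - F ((t : 𝕜) • h))
    refine mem_closure_of_tendsto (b := atTop)
      (f := fun s => StrongDual.toWeakDual ((t : 𝕜) • h + v s)) ?_
      (Eventually.of_forall fun s => Set.mem_image_of_mem _ ?_)
    · rw [tendsto_iff_forall_eval_tendsto_topDualPairing]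
      intro y
      refine tendsto_const_nhds.congr' ?_
      filter_upwards [eventually_ge_atTop {y}] with s hs
      have := hv s y (Finset.mem_insert_of_mem (hs (Finset.mem_singleton_self y)))
      change ((t : 𝕜) • h) y = ((t : 𝕜) • h + v s) y
      simp [this]
    · have hvx := hv s x (Finset.mem_insert_self x s)
      have h1 : ((t : 𝕜) • h + v s) x = (t : 𝕜) := by simp [hvx, hh]
      have h2 : F ((t : 𝕜) • h + v s) = ((t⁻¹ : ℝ) : 𝕜) := by rw [map_add, hFv]; ring
      simp only [reciprocalEpigraph, Set.mem_ofPred_eq, h1, h2, RCLike.ofReal_re]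
      exact ⟨ht, le_rfl⟩
  have hc : Continuous fun t : ℝ => StrongDual.toWeakDual ((t : 𝕜) • h) :=
    NormedSpace.Dual.toWeakDual_continuous.comp (by fun_prop)
  have hlim : Tendsto (fun t : ℝ => StrongDual.toWeakDual ((t : 𝕜) • h)) (𝓝[>] 0)
      (𝓝 (StrongDual.toWeakDual (0 : StrongDual 𝕜 X))) := by
    simpa using (hc.tendsto 0).mono_left nhdsWithin_le_nhds
  exact (isClosed_closure (X := WeakDual 𝕜 X)).mem_of_tendsto hlim (eventually_mem_nhdsWithin.mono key)

theorem zero_notMem_weakStarDerivedSet_reciprocalEpigraph :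
    0 ∉ weakStarDerivedSet (reciprocalEpigraph F x) := by
  simp only [weakStarDerivedSet, Set.mem_iUnion, not_exists]
  intro n _ h0
  -- A weak* closed condition, forced by `re (F f) ≤ ‖F‖ * n` on the ball, that fails at `0`.
  have hclosed : IsClosed {f : WeakDual 𝕜 X | 1 ≤ ‖F‖ * n * RCLike.re (f x)} :=
    isClosed_le continuous_const
      (continuous_const.mul (RCLike.continuous_re.comp (WeakDual.eval_continuous x)))
  have hsub : StrongDual.toWeakDual '' (reciprocalEpigraph F x ∩ Metric.closedBall 0 (n : ℝ)) ⊆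
      {f : WeakDual 𝕜 X | 1 ≤ ‖F‖ * n * RCLike.re (f x)} := by
    rintro _ ⟨f, ⟨⟨hpos, hf⟩, hn⟩, rfl⟩
    have hFf : RCLike.re (F f) ≤ ‖F‖ * n :=
      (RCLike.re_le_norm _).trans (F.le_opNorm_of_le (mem_closedBall_zero_iff.1 hn))
    exact (inv_le_iff_one_le_mul₀ hpos).1 (hf.trans hFf)
  have := closure_minimal hsub hclosed h0
  change 1 ≤ ‖F‖ * n * RCLike.re ((0 : StrongDual 𝕜 X) x) at this
  norm_num at this

end

theorem theorem2 {𝕜 : Type*} [RCLike 𝕜] {X : Type*} [NormedAddCommGroup X] [NormedSpace 𝕜 X]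
    [CompleteSpace X] (hX : ¬ IsReflexiveSpace 𝕜 X) :
    ∃ A : Set (StrongDual 𝕜 X), Convex ℝ A ∧ weakStarDerivedSet A ≠ weakStarClosure A := by
  obtain ⟨F, hF⟩ := not_forall.1 hX
  obtain ⟨x, hx⟩ : ∃ x : X, x ≠ 0 := by
    by_contra! h
    refine hF ⟨0, ContinuousLinearMap.ext fun f => ?_⟩
    have : f = 0 := ContinuousLinearMap.ext fun y => by simp [h y]
    simp [this]
  refine ⟨reciprocalEpigraph F x, convex_reciprocalEpigraph F x, fun h => ?_⟩
  exact zero_notMem_weakStarDerivedSet_reciprocalEpigraph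
    (h ▸ zero_mem_weakStarClosure_reciprocalEpigraph hF hx)
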